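/- Let $k$ be a field and $m\ge 1$ an integer. For a $k$-algebra $R$, an exponential map on $R$ is a $k$-algebra homomorphism $\phi=\phi_U:R\to R[U]$ such that (1) composing $\phi_U$ with the evaluation $R[U]\to R$ at $U=0$ gives $\mathrm{id}_R$, and (2) $\phi_V\phi_U=\phi_{U+V}$ as maps $R\to R[U,V]$, where $\phi_V:R\to R[V]$ is extended to $R[U]\to R[U,V]$ by $U\mapsto U$. Its ring of invariants is $R^\phi=\{b\in R: \phi(b)=b\}$, and $\phi$ is non-trivial if $R^\phi\ne R$. The Derksen invariant $\operatorname{DK}(R)$ is the $k$-subalgebra of $R$ generated by all elements of $R^\phi$, where $\phi$ runs over the non-trivial exponential maps on $R$. For $r=(r_1,\dots,r_m)\in\mathbb Z_{>1}^m$ and $F\in k[X_1,\dots,X_m,Z,T]$ put $$A(r,F)=\frac{k[X_1,\dots,X_m,Y,Z,T]}{\left(X_1^{r_1}\cdots X_m^{r_m}Y-F(X_1,\dots,X_m,Z,T)\right)}.$$ **Theorem.** Let $r=(r_1,\dots,r_m)$ and $s=(s_1,\dots,s_m)$ be in $\mathbb Z_{>1}^m$, and let $F,G\in k[X_1,\dots,X_m,Z,T]$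 be such that $f(Z,T):=F(0,\dots,0,Z,T)\neq0$ and $g(Z,T):=G(0,\dots,0,Z,T)\ne0$. Let $A=A(r,F)$ and $A'=A(s,G)$, and denote by $x_1,\dots,x_m,z,t$ and $x_1',\dots,x_m',z',t'$ the images of $X_1,\dots,X_m,Z,T$ in $A$ and $A'$ respectively. Let $E=k[x_1,\dots,x_m]$, $B=k[x_1,\dots,x_m,z,t]$, $E'=k[x_1',\dots,x_m']$ and $B'=k[x_1',\dots,x_m',z',t']$. Suppose that $\operatorname{DK}(A)=B$ and $\operatorname{DK}(A')=B'$, and let $\phi:A\to A'$ be an isomorphism of $k$-algebras. Then: (i) $\phi(B)=B'$ and $\phi(E)=E'$, so that $\phi$ restricts to isomorphisms $B\to B'$ and $E\to E'$. (ii) For each $i\in\{1,\dots,m\}$ there are $j\in\{1,\dots,m\}$ and $\lambda\in k^*$ such that $\phi(x_i)=\lambda x_j'$ and $r_i=s_j$. In particular, $(r_1,\dots,r_m)$ and $(s_1,\dots,s_m)$ agree up to a permutation of $\{1,\dots,m\}$. (iii) $\phi\left(\left(x_1^{r_1}\cdots x_m^{r_m},\,F(x_1,\dots,x_m,z,t)\right)B\right)=\left((x_1')^{s_1}\cdots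 (x_m')^{s_m},\,G(x_1',\dots,x_m',z',t')\right)B'$. (iv) There exist $\alpha\in\operatorname{Aut}_k(k[Z,T])$ and $\lambda\in k^*$ such that $\alpha(g)=\lambda f$. -/

import Mathlib

open scoped Polynomial

noncomputable section

namespace DerksenIso

section ExponentialMaps

variable {k : Type*} [Field k] {R : Type*} [CommRing R] [Algebra k R]

/-- A `k`-algebra homomorphism `φ : R → R[U]` is an exponential map on `R` if
* `ε₀ ∘ φ = id`, where `ε₀ : R[U] → R` is evaluation at `U = 0`;
* `φ_V ∘ φ_U = φ_{U+V}` as maps `R → R[U,V]`.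

The ring `R[U,V]` is written as `R[X][X]` (that is, `R[V][U]`): the inner variable
`Polynomial.C Polynomial.X` is `V` and the outer variable `Polynomial.X` is `U`. The extension of
`φ_V : R → R[V]` to `R[U] → R[V][U]` fixing `U` applies `φ` to each coefficient. -/
structure IsExponentialMap (φ : R →ₐ[k] R[X]) : Prop where
  eval_zero : ∀ b : R, (φ b).eval 0 = b
  comp_add : ∀ b : R, Polynomial.mapAlgHom φ (φ b) =
    Polynomial.aeval (Polynomial.X + Polynomial.C Polynomial.X : R[X][X]) (φ b)

/-- The ring of invariants `R^φ = {b ∈ R | φ b = b}`. -/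
def invariants (φ : R →ₐ[k] R[X]) : Subalgebra k R :=
  AlgHom.equalizer φ Polynomial.CAlgHom

variable (k R) in
/-- The Derksen invariant `DK(R)`: the `k`-subalgebra of `R` generated by the rings of invariants
of all non-trivial exponential maps on `R`. -/
def derksenInvariant : Subalgebra k R :=
  Algebra.adjoin k {b : R | ∃ φ : R →ₐ[k] R[X],
    IsExponentialMap φ ∧ invariants φ ≠ ⊤ ∧ b ∈ invariants φ}

end ExponentialMaps

section Hypersurface

variable {k : Type*} [Field k] {m : ℕ}

variable (k m) in
/-- The polynomial ring `k[X₁, …, X_m, Z, T]`: the variable `Sum.inl i` is `X_i`, `Sum.inr 0` is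
`Z` and `Sum.inr 1` is `T`. -/
abbrev PolyXZT : Type _ := MvPolynomial (Fin m ⊕ Fin 2) k

variable (k m) in
/-- The polynomial ring `k[X₁, …, X_m, Y, Z, T]`: the variable `none` is `Y`, and `some v` is the
variable `v` of `k[X₁, …, X_m, Z, T]`. -/
abbrev PolyXYZT : Type _ := MvPolynomial (Option (Fin m ⊕ Fin 2)) k

/-- `F(0, …, 0, Z, T)`, a polynomial in `k[Z, T]` (with `Z` the variable `0`, `T` the variable
`1`). -/
def atZero (F : PolyXZT k m) : MvPolynomial (Fin 2) k :=
  MvPolynomial.aeval (Sum.elim (fun _ => 0) MvPolynomial.X) F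

/-- The polynomial `X₁^{r₁} ⋯ X_m^{r_m} Y - F(X₁, …, X_m, Z, T)`. -/
def definingPoly (r : Fin m → ℕ) (F : PolyXZT k m) : PolyXYZT k m :=
  (∏ i, MvPolynomial.X (some (Sum.inl i)) ^ r i) * MvPolynomial.X none
    - MvPolynomial.rename some F

/-- The ring `A(r, F) = k[X₁, …, X_m, Y, Z, T] / (X₁^{r₁} ⋯ X_m^{r_m} Y - F)`. -/
abbrev Hyp (r : Fin m → ℕ) (F : PolyXZT k m) : Type _ :=
  PolyXYZT k m ⧸ Ideal.span {definingPoly r F}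

variable (r : Fin m → ℕ) (F : PolyXZT k m)

/-- The image `x_i` of `X_i` in `A(r, F)`. -/
def xx (i : Fin m) : Hyp r F := Ideal.Quotient.mk _ (MvPolynomial.X (some (Sum.inl i)))

/-- The image `z` of `Z` in `A(r, F)`. -/
def zz : Hyp r F := Ideal.Quotient.mk _ (MvPolynomial.X (some (Sum.inr 0)))

/-- The image `t` of `T` in `A(r, F)`. -/
def tt : Hyp r F := Ideal.Quotient.mk _ (MvPolynomial.X (some (Sum.inr 1)))

/-- The subring `E = k[x₁, …, x_m]` of `A(r, F)`. -/
def subE : Subalgebra k (Hyp r F) := Algebra.adjoin k (Set.range (xx r F))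

/-- The subring `B = k[x₁, …, x_m, z, t]` of `A(r, F)`. -/
def subB : Subalgebra k (Hyp r F) :=
  Algebra.adjoin k (Set.range (xx r F) ∪ {zz r F, tt r F})

/-- The generator `x_i`, as an element of `B`. -/
def bx (i : Fin m) : subB r F :=
  ⟨xx r F i, Algebra.subset_adjoin (Or.inl ⟨i, rfl⟩)⟩

/-- The generator `z`, as an element of `B`. -/
def bz : subB r F := ⟨zz r F, Algebra.subset_adjoin (Or.inr (Or.inl rfl))⟩

/-- The generator `t`, as an element of `B`. -/
def bt : subB r F := ⟨tt r F, Algebra.subset_adjoin (Or.inr (Or.inr rfl))⟩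

/-- The ideal `(x₁^{r₁} ⋯ x_m^{r_m}, F(x₁, …, x_m, z, t))` of the ring `B`. -/
def idealB : Ideal (subB r F) :=
  Ideal.span {∏ i, bx r F i ^ r i,
    MvPolynomial.aeval (Sum.elim (bx r F) ![bz r F, bt r F]) F}

end Hypersurface

end DerksenIso

end

open scoped Polynomial

noncomputable section

namespace DerksenIso

/-! ### Exponential maps, isomorphisms and units. -/

section Transport

variable {k : Type*} [Field k] {R S : Type*} [CommRing R] [Algebra k R] [CommRing S] [Algebra k S]

/-! Isomorphisms transport exponential maps, so `φ` carries `DK(A) = B` onto `DK(A') = B'`. Both are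
polynomial rings, hence `φ` restricts to an automorphism `θ` of `k[X, Z, T]`, and everything is read
off from `θ`.

The variables: inverting the monomial turns `A` into a localization of `B`. Clearing denominators in
`φ⁻¹(y')` shows that each `X_i` divides some `θ(X_j)`, so `θ` permutes the `X_i` up to scalars
(`exists_perm_lift_X`).

The ideals: if `e` divides the monomial, `eA ∩ B = (e, F)` (`incl_dvd_incl_iff`), so `θ` matches
`(e, F)` with `(θ e, G)`. Taking `e` to be the whole monomial gives (iii); setting all `X_i = 0`
then gives (iv).

The exponents (`exponent_le`): a strict inequality would make `G` at `X_i = 0` a nonzero constant.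
Then `x_i'` would be a unit of `A'`, which `DK(A') = B'` forbids (`not_isUnit_incl_X`). -/

/-- The transport of an algebra homomorphism `R → R[U]` along an isomorphism `R ≃ S`. -/
def conjExp (e : R ≃ₐ[k] S) (ψ : R →ₐ[k] R[X]) : S →ₐ[k] S[X] :=
  (Polynomial.mapAlgHom (e : R →ₐ[k] S)).comp (ψ.comp (e.symm : S →ₐ[k] R))

theorem conjExp_apply (e : R ≃ₐ[k] S) (ψ : R →ₐ[k] R[X]) (b : R) :
    conjExp e ψ (e b) = (ψ b).map (e : R →+* S) := by
  simp [conjExp]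

theorem mem_invariants_conjExp (e : R ≃ₐ[k] S) (ψ : R →ₐ[k] R[X]) (b : R) :
    e b ∈ invariants (conjExp e ψ) ↔ b ∈ invariants ψ := by
  have h1 : e b ∈ invariants (conjExp e ψ) ↔ conjExp e ψ (e b) = Polynomial.C (e b) := Iff.rfl
  have h2 : b ∈ invariants ψ ↔ ψ b = Polynomial.C b := Iff.rfl
  rw [h1, h2, conjExp_apply, ← (Polynomial.map_injective (e : R →+* S) e.injective).eq_iff,
    Polynomial.map_C]
  rfl

theorem IsExponentialMap.conjExp {ψ : R →ₐ[k] R[X]} (hψ : IsExponentialMap ψ) (e : R ≃ₐ[k] S) :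
    IsExponentialMap (conjExp e ψ) where
  eval_zero b := by
    obtain ⟨b, rfl⟩ := e.surjective b
    have h := congrArg e (hψ.eval_zero b)
    rw [conjExp_apply, ← map_zero (e : R →+* S), Polynomial.eval_map, Polynomial.eval₂_hom]
    exact h
  comp_add b := by
    obtain ⟨b, rfl⟩ := e.surjective b
    have h := congrArg (Polynomial.map (Polynomial.mapRingHom (e : R →+* S))) (hψ.comp_add b)
    rw [conjExp_apply]
    have h1 : Polynomial.mapAlgHom (DerksenIso.conjExp e ψ) ((ψ b).map (e : R →+* S)) =
        Polynomial.map (Polynomial.mapRingHom (e : R →+* S)) (Polynomial.mapAlgHom ψ (ψ b)) := by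
      ext i : 1
      simp only [Polynomial.coe_mapAlgHom, Polynomial.coeff_map]
      exact conjExp_apply e ψ _
    rw [h1, h]
    have h2 : ∀ p : R[X], Polynomial.map (Polynomial.mapRingHom (e : R →+* S))
        (Polynomial.aeval (Polynomial.X + Polynomial.C Polynomial.X : R[X][X]) p) =
        Polynomial.aeval (Polynomial.X + Polynomial.C Polynomial.X : S[X][X])
          (p.map (e : R →+* S)) := by
      intro p
      induction p using Polynomial.induction_on' with
      | add p q hp hq => simp only [map_add, Polynomial.map_add, hp, hq]
      | monomial n a =>
        simp [Polynomial.aeval_monomial, Polynomial.map_monomial, Polynomial.algebraMap_apply]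
    exact h2 _

theorem map_derksenInvariant_le (e : R ≃ₐ[k] S) :
    (derksenInvariant k R).map (e : R →ₐ[k] S) ≤ derksenInvariant k S := by
  rw [derksenInvariant, AlgHom.map_adjoin, Algebra.adjoin_le_iff]
  rintro _ ⟨b, ⟨ψ, hψ, hne, hb⟩, rfl⟩
  refine Algebra.subset_adjoin ⟨conjExp e ψ, hψ.conjExp e, fun h => hne ?_,
    (mem_invariants_conjExp e ψ b).2 hb⟩
  rw [eq_top_iff]
  intro a _
  rw [← mem_invariants_conjExp e, h]
  trivial

theorem map_derksenInvariant (e : R ≃ₐ[k] S) :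
    (derksenInvariant k R).map (e : R →ₐ[k] S) = derksenInvariant k S := by
  refine le_antisymm (map_derksenInvariant_le e) fun b hb => ?_
  exact ⟨e.symm b, map_derksenInvariant_le e.symm ⟨b, hb, rfl⟩, e.apply_symm_apply b⟩

/-- Over a domain the units of `R[U]` are constants, and evaluation at `U = 0` identifies the
constant. -/
theorem mem_invariants_of_isUnit [IsDomain R] (ψ : R →ₐ[k] R[X]) (hψ : IsExponentialMap ψ)
    {b : R} (hb : IsUnit b) : b ∈ invariants ψ := by
  obtain ⟨c, -, hc⟩ := Polynomial.isUnit_iff.1 (hb.map ψ)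
  have h := hψ.eval_zero b
  rw [← hc, Polynomial.eval_C] at h
  subst h
  exact hc.symm

/-- The Derksen invariant of a domain is either `k` or contains all units. -/
theorem derksenInvariant_eq_bot_or [IsDomain R] :
    derksenInvariant k R = ⊥ ∨ ∀ b : R, IsUnit b → b ∈ derksenInvariant k R := by
  by_cases h : ∃ ψ : R →ₐ[k] R[X], IsExponentialMap ψ ∧ invariants ψ ≠ ⊤
  · obtain ⟨ψ, hψ, hne⟩ := h
    exact Or.inr fun b hb =>
      Algebra.subset_adjoin ⟨ψ, hψ, hne, mem_invariants_of_isUnit ψ hψ hb⟩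
  · refine Or.inl ?_
    rw [derksenInvariant, ← Algebra.adjoin_empty]
    congr 1
    refine Set.eq_empty_of_forall_notMem ?_
    rintro b ⟨ψ, hψ, hne, -⟩
    exact h ⟨ψ, hψ, hne⟩

end Transport

/-! ### Primality of the defining polynomial. -/

section Polynomials

variable {k : Type*} [Field k] {m : ℕ}

/-- The monomial `X₁^{r₁} ⋯ X_m^{r_m}`. -/
def monX (r : Fin m → ℕ) : PolyXZT k m := ∏ i, MvPolynomial.X (Sum.inl i) ^ r i

theorem atZero_X_inl (i : Fin m) :
    atZero (k := k) (m := m) (MvPolynomial.X (Sum.inl i)) = 0 := by simp [atZero]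

theorem atZero_mul (p q : PolyXZT k m) : atZero (p * q) = atZero p * atZero q :=
  map_mul (MvPolynomial.aeval _) p q

theorem not_X_dvd_of_atZero_ne_zero {F : PolyXZT k m} (hf : atZero F ≠ 0) (i : Fin m) :
    ¬ MvPolynomial.X (Sum.inl i) ∣ F := by
  rintro ⟨q, rfl⟩
  exact hf (by rw [atZero_mul, atZero_X_inl, zero_mul])

theorem irreducible_X (v : Fin m ⊕ Fin 2) : Irreducible (MvPolynomial.X v : PolyXZT k m) :=
  MvPolynomial.X_prime.irreducible

theorem isRelPrime_monX {F : PolyXZT k m} (hf : atZero F ≠ 0) (r : Fin m → ℕ) :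
    IsRelPrime (monX r) F :=
  IsRelPrime.prod_left fun i _ => IsRelPrime.pow_left
    ((irreducible_X _).isRelPrime_iff_not_dvd.2 (not_X_dvd_of_atZero_ne_zero hf i))

theorem monX_ne_zero (r : Fin m → ℕ) : (monX r : PolyXZT k m) ≠ 0 :=
  Finset.prod_ne_zero_iff.2 fun _ _ => pow_ne_zero _ (MvPolynomial.X_ne_zero _)

theorem X_pow_dvd_monX (r : Fin m → ℕ) (i : Fin m) :
    MvPolynomial.X (Sum.inl i) ^ r i ∣ (monX r : PolyXZT k m) :=
  Finset.dvd_prod_of_mem (fun i => (MvPolynomial.X (Sum.inl i) : PolyXZT k m) ^ r i)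
    (Finset.mem_univ i)

theorem optionEquivLeft_rename_some (p : PolyXZT k m) :
    MvPolynomial.optionEquivLeft k _ (MvPolynomial.rename some p) = Polynomial.C p := by
  induction p using MvPolynomial.induction_on with
  | C a => simp
  | add p q hp hq => simp [hp, hq]
  | mul_X p i hp => simp [hp]

theorem definingPoly_eq (r : Fin m → ℕ) (F : PolyXZT k m) :
    definingPoly r F =
      MvPolynomial.rename some (monX r) * MvPolynomial.X none - MvPolynomial.rename some F := by
  simp [definingPoly, monX, map_prod]

theorem optionEquivLeft_definingPoly (r : Fin m → ℕ) (F : PolyXZT k m) :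
    MvPolynomial.optionEquivLeft k _ (definingPoly r F) =
      Polynomial.C (monX r) * Polynomial.X + Polynomial.C (-F) := by
  rw [definingPoly_eq, map_sub, map_mul, optionEquivLeft_rename_some, optionEquivLeft_rename_some,
    MvPolynomial.optionEquivLeft_X_none, map_neg, sub_eq_add_neg]

/-- The polynomial is linear in `Y` with coprime coefficients, since no `X_i` divides `F`. -/
theorem prime_definingPoly (r : Fin m → ℕ) {F : PolyXZT k m} (hf : atZero F ≠ 0) :
    Prime (definingPoly r F) := by
  rw [← MulEquiv.prime_iff (MvPolynomial.optionEquivLeft k (Fin m ⊕ Fin 2)),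
    optionEquivLeft_definingPoly, ← irreducible_iff_prime]
  refine Polynomial.irreducible_C_mul_X_add_C (monX_ne_zero r) ?_
  have h := isRelPrime_monX hf r
  exact fun d h1 h2 => h h1 ((dvd_neg).1 h2)

theorem isDomain_hyp (r : Fin m → ℕ) {F : PolyXZT k m} (hf : atZero F ≠ 0) :
    IsDomain (Hyp r F) := by
  have h := prime_definingPoly r hf
  have : (Ideal.span {definingPoly r F}).IsPrime := (Ideal.span_singleton_prime h.ne_zero).2 h
  exact Ideal.Quotient.isDomain _

end Polynomials

/-! ### The ring `A` over its polynomial subring `B`. -/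

section Structure

variable {k : Type*} [Field k] {m : ℕ} (r : Fin m → ℕ) (F : PolyXZT k m)

/-- The homomorphism `k[X₁, …, X_m, Z, T] → A(r, F)`. -/
def incl : PolyXZT k m →ₐ[k] Hyp r F :=
  (Ideal.Quotient.mkₐ k _).comp (MvPolynomial.rename some)

/-- The image `y` of `Y` in `A(r, F)`. -/
def yy : Hyp r F := Ideal.Quotient.mk _ (MvPolynomial.X none)

theorem incl_X_inl (i : Fin m) : incl r F (MvPolynomial.X (Sum.inl i)) = xx r F i := by
  simp [incl, xx]

theorem incl_eq_aeval :
    incl r F = MvPolynomial.aeval (Sum.elim (xx r F) ![zz r F, tt r F]) := by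
  ext v
  rcases v with i | v
  · simp [incl, xx]
  · fin_cases v <;> simp [incl, zz, tt]

theorem range_incl : (incl r F).range = subB r F := by
  rw [incl_eq_aeval, subB, ← Algebra.adjoin_range_eq_range_aeval]
  congr 1
  rw [Set.Sum.elim_range]
  congr 1
  ext a
  simp [or_comm]

theorem incl_monX_mul_yy : incl r F (monX r) * yy r F = incl r F F := by
  have h : Ideal.Quotient.mk (Ideal.span {definingPoly r F}) (definingPoly r F) = 0 :=
    Ideal.Quotient.eq_zero_iff_mem.2 (Ideal.mem_span_singleton_self _)
  have h2 : incl r F (monX r) * yy r F - incl r F F = 0 :=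
    (congrArg (Ideal.Quotient.mk _) (definingPoly_eq r F)).symm.trans h
  exact sub_eq_zero.1 h2

/-- Modulo `(e, F)` the defining polynomial vanishes, so `Y` stays a free variable and a multiple of
`e` has all its `Y`-coefficients in `(e, F)`. -/
theorem mem_span_of_incl_add_mul_mem {e p q : PolyXZT k m} (he : e ∣ monX r) {a : Hyp r F}
    (h : incl r F p + incl r F q * yy r F = incl r F e * a) :
    p ∈ Ideal.span {e, F} ∧ q ∈ Ideal.span {e, F} := by
  obtain ⟨a, rfl⟩ := Ideal.Quotient.mk_surjective a
  have h' : Ideal.Quotient.mk (Ideal.span {definingPoly r F})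
      (MvPolynomial.rename some p + MvPolynomial.rename some q * MvPolynomial.X none) =
      Ideal.Quotient.mk _ (MvPolynomial.rename some e * a) := by
    rw [map_add, map_mul, map_mul]
    exact h
  rw [Ideal.Quotient.eq, Ideal.mem_span_singleton] at h'
  obtain ⟨w, hw⟩ := h'
  have h2 := congrArg (MvPolynomial.optionEquivLeft k (Fin m ⊕ Fin 2)) hw
  simp only [map_sub, map_add, map_mul, optionEquivLeft_rename_some,
    MvPolynomial.optionEquivLeft_X_none, optionEquivLeft_definingPoly] at h2
  have heI : e ∈ Ideal.span {e, F} := Ideal.subset_span (Or.inl rfl)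
  have hFI : F ∈ Ideal.span {e, F} := Ideal.subset_span (Or.inr rfl)
  have hmem : Polynomial.C p + Polynomial.C q * Polynomial.X ∈
      (Ideal.span {e, F}).map (Polynomial.C : PolyXZT k m →+* (PolyXZT k m)[X]) := by
    rw [sub_eq_iff_eq_add] at h2
    rw [h2]
    refine add_mem (Ideal.mul_mem_right _ _ (add_mem (Ideal.mul_mem_right _ _ ?_) ?_))
      (Ideal.mul_mem_right _ _ ?_)
    · exact Ideal.mem_map_of_mem _ (Ideal.mem_of_dvd _ he heI)
    · exact Ideal.mem_map_of_mem Polynomial.C (neg_mem hFI)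
    · exact Ideal.mem_map_of_mem _ heI
  rw [Ideal.mem_map_C_iff] at hmem
  exact ⟨by simpa using hmem 0, by simpa using hmem 1⟩

theorem incl_dvd_incl_iff {e : PolyXZT k m} (he : e ∣ monX r) (p : PolyXZT k m) :
    incl r F e ∣ incl r F p ↔ p ∈ Ideal.span {e, F} := by
  constructor
  · rintro ⟨a, ha⟩
    exact (mem_span_of_incl_add_mul_mem r F he (q := 0) (a := a) (by simpa using ha)).1
  · intro h
    obtain ⟨a, b, rfl⟩ := Ideal.mem_span_pair.1 h
    rw [map_add, map_mul, map_mul, ← incl_monX_mul_yy]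
    exact dvd_add (dvd_mul_left _ _)
      (Dvd.dvd.mul_left (Dvd.dvd.mul_right (map_dvd (incl r F) he) _) _)

theorem incl_injective : Function.Injective (incl r F) := by
  rw [injective_iff_map_eq_zero]
  intro p hp
  have h : Ideal.Quotient.mk (Ideal.span {definingPoly r F}) (MvPolynomial.rename some p) = 0 := hp
  rw [Ideal.Quotient.eq_zero_iff_mem, Ideal.mem_span_singleton] at h
  have h2 := map_dvd (MvPolynomial.optionEquivLeft k (Fin m ⊕ Fin 2)) h
  rw [optionEquivLeft_rename_some, optionEquivLeft_definingPoly] at h2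
  by_contra hne
  have h3 := Polynomial.degree_le_of_dvd h2 (Polynomial.C_ne_zero.2 hne)
  rw [Polynomial.degree_linear (monX_ne_zero r)] at h3
  have h4 := h3.trans Polynomial.degree_C_le
  exact absurd h4 (by decide)

/-- Inverting the monomial makes `y = F / monX r` a fraction over `B`. -/
theorem exists_incl_monX_pow_mul (a : Hyp r F) :
    ∃ n p, incl r F (monX r) ^ n * a = incl r F p := by
  obtain ⟨a, rfl⟩ := Ideal.Quotient.mk_surjective a
  induction a using MvPolynomial.induction_on with
  | C c => exact ⟨0, MvPolynomial.C c, by rw [pow_zero, one_mul, incl]; simp; rfl⟩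
  | add p q hp hq =>
    obtain ⟨n, p', hp⟩ := hp
    obtain ⟨l, q', hq⟩ := hq
    refine ⟨n + l, monX r ^ l * p' + monX r ^ n * q', ?_⟩
    simp only [map_add, map_mul, map_pow, ← hp, ← hq]
    ring
  | mul_X p v hp =>
    obtain ⟨n, p', hp⟩ := hp
    rcases v with _ | v
    · refine ⟨n + 1, p' * F, ?_⟩
      simp only [map_mul, ← hp, ← incl_monX_mul_yy, yy]
      ring
    · refine ⟨n, p' * MvPolynomial.X v, ?_⟩
      simp only [map_mul, ← hp, mul_assoc]
      simp [incl]

end Structure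


/-! ### The automorphism `θ` of the polynomial ring: variables and exponents. -/

section Isomorphisms

variable {k : Type*} [Field k] {m : ℕ} {r s : Fin m → ℕ} {F G : PolyXZT k m}

theorem isUnit_iff_exists_C {u : PolyXZT k m} :
    IsUnit u ↔ ∃ c : k, c ≠ 0 ∧ u = MvPolynomial.C c := by
  rw [MvPolynomial.isUnit_iff_eq_C_of_isReduced]
  simp only [isUnit_iff_ne_zero]

/-- If `DK(A') = k`, then `x_i'` would be a scalar; otherwise the inverse of `x_i'` would lie in
`DK(A') = B'`, a polynomial ring. -/
theorem not_isUnit_incl_X (hg : atZero G ≠ 0) (hDK : derksenInvariant k (Hyp s G) = subB s G)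
    (i : Fin m) : ¬ IsUnit (incl s G (MvPolynomial.X (Sum.inl i))) := by
  intro hu
  have := isDomain_hyp s hg
  rcases derksenInvariant_eq_bot_or (k := k) (R := Hyp s G) with h | h
  · have hmem : incl s G (MvPolynomial.X (Sum.inl i)) ∈ (incl s G).range := ⟨_, rfl⟩
    rw [range_incl, ← hDK, h, Algebra.mem_bot] at hmem
    obtain ⟨c, hc⟩ := hmem
    have hX : (MvPolynomial.C c : PolyXZT k m) = MvPolynomial.X (Sum.inl i) := by
      apply incl_injective s G
      rw [← hc]
      exact (incl s G).commutes c
    have hc0 : c ≠ 0 := by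
      rintro rfl
      rw [map_zero] at hX
      exact MvPolynomial.X_ne_zero _ hX.symm
    exact (irreducible_X (k := k) (m := m) (Sum.inl i)).not_isUnit
      (isUnit_iff_exists_C.2 ⟨c, hc0, hX.symm⟩)
  · obtain ⟨u, hu⟩ := hu
    have hmem := h _ u⁻¹.isUnit
    rw [hDK, ← range_incl] at hmem
    obtain ⟨p, hp⟩ := hmem
    have h1 : MvPolynomial.X (Sum.inl i) * p = 1 := by
      apply incl_injective s G
      rw [map_mul, ← hu, map_one]
      exact (congrArg _ hp).trans u.mul_inv
    exact (irreducible_X (k := k) (m := m) (Sum.inl i)).not_isUnit (IsUnit.of_mul_eq_one p h1)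

theorem X_dvd_sub_aeval_update (v : Fin m ⊕ Fin 2) (p : PolyXZT k m) :
    MvPolynomial.X v ∣ p - MvPolynomial.aeval (Function.update MvPolynomial.X v 0) p := by
  induction p using MvPolynomial.induction_on with
  | C a => simp [MvPolynomial.algebraMap_eq]
  | add p q hp hq =>
    rw [map_add, add_sub_add_comm]
    exact dvd_add hp hq
  | mul_X p w hp =>
    rw [map_mul, MvPolynomial.aeval_X]
    by_cases hw : w = v
    · subst hw
      simp
    · rw [Function.update_of_ne hw, ← sub_mul]
      exact hp.mul_right _

theorem atZero_aeval_update (i : Fin m) (p : PolyXZT k m) :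
    atZero (MvPolynomial.aeval (Function.update MvPolynomial.X (Sum.inl i) 0) p) = atZero p := by
  have h := X_dvd_sub_aeval_update (Sum.inl i) p
  obtain ⟨q, hq⟩ := h
  have h2 : atZero (p - MvPolynomial.aeval (Function.update MvPolynomial.X (Sum.inl i) 0) p) =
      0 := by
    rw [hq, atZero_mul, atZero_X_inl, zero_mul]
  rw [atZero, map_sub, sub_eq_zero] at h2
  exact h2.symm

variable (φ : Hyp r F ≃ₐ[k] Hyp s G) (θ : PolyXZT k m ≃ₐ[k] PolyXZT k m)

theorem exists_lift (hB : (subB r F).map (φ : Hyp r F →ₐ[k] Hyp s G) = subB s G) :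
    ∃ θ : PolyXZT k m ≃ₐ[k] PolyXZT k m, ∀ p, incl s G (θ p) = φ (incl r F p) := by
  rw [← range_incl, ← range_incl] at hB
  let e₁ := AlgEquiv.ofInjective (incl r F) (incl_injective r F)
  let e₂ := AlgEquiv.ofInjective (incl s G) (incl_injective s G)
  let e := (φ.subalgebraMap (incl r F).range).trans (Subalgebra.equivOfEq _ _ hB)
  refine ⟨(e₁.trans e).trans e₂.symm, fun p => ?_⟩
  have h : e₂ (e₂.symm (e (e₁ p))) = e (e₁ p) := e₂.apply_symm_apply _
  exact congrArg Subtype.val h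

variable {φ θ}

theorem incl_lift_symm (hθ : ∀ p, incl s G (θ p) = φ (incl r F p))
    (p : PolyXZT k m) : incl r F (θ.symm p) = φ.symm (incl s G p) := by
  rw [AlgEquiv.eq_symm_apply, ← hθ, θ.apply_symm_apply]

theorem exists_associated_X (hθ : ∀ p, incl s G (θ p) = φ (incl r F p))
    (hg : atZero G ≠ 0) (hs : ∀ i, 0 < s i) (i : Fin m) :
    ∃ j, Associated (MvPolynomial.X (Sum.inl i)) (θ (MvPolynomial.X (Sum.inl j))) := by
  obtain ⟨n, p, hp⟩ := exists_incl_monX_pow_mul r F (φ.symm (yy s G))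
  -- This is `monX s * y' = G` with the denominator of `φ⁻¹(y')` cleared.
  have h1 : θ (monX r) ^ n * G = monX s * θ p := by
    apply incl_injective s G
    rw [map_mul, ← incl_monX_mul_yy, map_mul, hθ, ← hp, map_pow, hθ, map_mul, map_pow,
      φ.apply_symm_apply]
    ring
  have hX : Prime (MvPolynomial.X (Sum.inl i) : PolyXZT k m) := MvPolynomial.X_prime
  have h2 : MvPolynomial.X (Sum.inl i) ∣ θ (monX r) ^ n * G := by
    rw [h1]
    exact ((dvd_pow_self _ (hs i).ne').trans (X_pow_dvd_monX s i)).mul_right _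
  have h3 := hX.dvd_of_dvd_pow ((hX.dvd_or_dvd h2).resolve_right (not_X_dvd_of_atZero_ne_zero hg i))
  rw [monX, map_prod] at h3
  obtain ⟨j, -, hj⟩ := hX.exists_mem_finset_dvd h3
  rw [map_pow] at hj
  refine ⟨j, hX.irreducible.associated_of_dvd ?_ (hX.dvd_of_dvd_pow hj)⟩
  exact (MulEquiv.irreducible_iff θ).2 (irreducible_X _)

theorem exists_perm_lift_X (hθ : ∀ p, incl s G (θ p) = φ (incl r F p))
    (hg : atZero G ≠ 0) (hs : ∀ i, 0 < s i) :
    ∃ σ : Equiv.Perm (Fin m), ∀ j, ∃ c : k, c ≠ 0 ∧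
      θ (MvPolynomial.X (Sum.inl j)) = MvPolynomial.C c * MvPolynomial.X (Sum.inl (σ j)) := by
  choose τ hτ using exists_associated_X hθ hg hs
  have hinj : Function.Injective τ := by
    intro i i' h
    have h1 := ((hτ i).trans ((congrArg (fun j => θ (MvPolynomial.X (Sum.inl j))) h) ▸
      (hτ i').symm)).dvd
    exact Sum.inl_injective (MvPolynomial.X_dvd_X.1 h1)
  let e := Equiv.ofBijective τ (Finite.injective_iff_bijective.1 hinj)
  refine ⟨e.symm, fun j => ?_⟩
  obtain ⟨u, hu⟩ := hτ (e.symm j)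
  obtain ⟨c, hc, huc⟩ := isUnit_iff_exists_C.1 u.isUnit
  refine ⟨c, hc, ?_⟩
  have he : τ (e.symm j) = j := e.apply_symm_apply j
  rw [he] at hu
  rw [← hu, huc, mul_comm]

/-- Both ideals are contractions of principal ideals, so they correspond under `φ`. -/
theorem mem_span_lift_iff (hθ : ∀ p, incl s G (θ p) = φ (incl r F p))
    {e : PolyXZT k m} (h1 : e ∣ monX r) (h2 : θ e ∣ monX s)
    (p : PolyXZT k m) : θ p ∈ Ideal.span {θ e, G} ↔ p ∈ Ideal.span {e, F} := by
  rw [← incl_dvd_incl_iff s G h2, ← incl_dvd_incl_iff r F h1, hθ, hθ]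
  exact map_dvd_iff φ

/-- If `r j > s i`, then `θ F` is divisible in `A'` by one more power of `x = θ(X_j)` than `monX s`
contains. Dividing by `x ^ s i` leaves a relation linear in `y'`, whose coefficients must lie in
`(x, G)`. -/
theorem exponent_le (hθ : ∀ p, incl s G (θ p) = φ (incl r F p))
    (hg : atZero G ≠ 0) (hDK : derksenInvariant k (Hyp s G) = subB s G)
    (hs : ∀ i, 0 < s i) {i j : Fin m} {c : k} (hc : c ≠ 0)
    (hij : θ (MvPolynomial.X (Sum.inl j)) = MvPolynomial.C c * MvPolynomial.X (Sum.inl i)) :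
    r j ≤ s i := by
  by_contra! hlt
  have := isDomain_hyp s hg
  set x : PolyXZT k m := θ (MvPolynomial.X (Sum.inl j)) with hx
  set ψ : PolyXZT k m →ₐ[k] PolyXZT k m :=
    MvPolynomial.aeval (Function.update MvPolynomial.X (Sum.inl i) 0) with hψ
  have hψx : ψ x = 0 := by simp [hij, hψ]
  have hC : MvPolynomial.C c * MvPolynomial.C c⁻¹ = (1 : PolyXZT k m) := by
    rw [← map_mul, mul_inv_cancel₀ hc, map_one]
  -- The cofactor of `x ^ s i` in `monX s`; it is free of `X_i`, and the scalar compensates `x = c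
  -- X_i`.
  set v : PolyXZT k m := MvPolynomial.C c⁻¹ ^ s i *
    ∏ l ∈ Finset.univ.erase i, MvPolynomial.X (Sum.inl l) ^ s l with hv
  have hmon : monX s = x ^ s i * v := by
    rw [hv, hij, mul_pow, monX, ← Finset.mul_prod_erase _ _ (Finset.mem_univ i)]
    calc _ = (MvPolynomial.C c * MvPolynomial.C c⁻¹) ^ s i * _ := by rw [hC, one_pow, one_mul]
      _ = _ := by ring
  have hψv : ψ v = v := by
    rw [hv, map_mul, map_pow, map_prod, hψ, MvPolynomial.aeval_C]
    congr 1
    refine Finset.prod_congr rfl fun l hl => ?_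
    rw [map_pow, MvPolynomial.aeval_X, Function.update_of_ne]
    exact fun h => (Finset.ne_of_mem_erase hl) (Sum.inl_injective h)
  obtain ⟨w, hw⟩ : (MvPolynomial.X (Sum.inl j) : PolyXZT k m) ^ (s i + 1) ∣ monX r :=
    (pow_dvd_pow _ hlt).trans (X_pow_dvd_monX r j)
  have hiff := fun p => mem_span_lift_iff hθ (e := MvPolynomial.X (Sum.inl j) ^ s i)
    ⟨MvPolynomial.X (Sum.inl j) * w, by rw [hw]; ring⟩
    (by rw [map_pow]; exact ⟨v, hmon⟩) p
  rw [map_pow, ← hx] at hiff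
  obtain ⟨b, d, hF⟩ := Ideal.mem_span_pair.1
    ((hiff F).2 (Ideal.subset_span (Or.inr rfl)))
  obtain ⟨b', d', hG⟩ := Ideal.mem_span_pair.1
    ((hiff (θ.symm G)).1 (by rw [θ.apply_symm_apply]; exact Ideal.subset_span (Or.inr rfl)))
  replace hG := congrArg θ hG
  rw [map_add, map_mul, map_mul, map_pow, ← hx, θ.apply_symm_apply, ← hF] at hG
  -- `θ F = b x ^ s i + d G` with `G = x ^ s i v y'`, divided by `x ^ s i`.
  have hcancel : incl s G b + incl s G (d * v) * yy s G =
      incl s G x * φ (incl r F w * yy r F) := by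
    have hxs : incl s G (x ^ s i) ≠ 0 := by
      rw [Ne, map_eq_zero_iff _ (incl_injective s G)]
      rintro h0
      rw [h0, zero_mul] at hmon
      exact monX_ne_zero s hmon
    apply mul_left_cancel₀ hxs
    have h1 : incl s G (θ F) = φ (incl r F (monX r) * yy r F) := by
      rw [hθ, incl_monX_mul_yy]
    have h2 : φ (incl r F (monX r) * yy r F) =
        incl s G (x ^ s i) * (incl s G x * φ (incl r F w * yy r F)) := by
      rw [hw]
      simp only [map_mul, map_pow, hx, hθ]
      ring
    rw [← h2, ← h1, ← hF, map_add, map_mul (incl s G) b, map_mul (incl s G) d G,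
      ← incl_monX_mul_yy s G, hmon, map_mul (incl s G) d v, map_mul (incl s G) _ v]
    ring
  have hxdvd : x ∣ monX s :=
    (dvd_pow_self _ (hs i).ne').trans ⟨v, hmon⟩
  obtain ⟨p, q, hpq⟩ :=
    Ideal.mem_span_pair.1 (mem_span_of_incl_add_mul_mem s G hxdvd hcancel).2
  have hψG : ψ G ≠ 0 := by
    intro h0
    apply hg
    rw [← atZero_aeval_update i G, ← hψ, h0]
    exact map_zero (MvPolynomial.aeval _)
  have hdvd : ψ G ∣ v := by
    have h1 : ψ (d * v) = ψ q * ψ G := by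
      rw [← hpq, map_add, map_mul, map_mul, hψx, mul_zero, zero_add]
    -- Each of `G`, `θ F` is a multiple of the other at `X_i = 0`, so `ψ d` is invertible and can be
    -- removed from `ψ G ∣ ψ d * v`.
    have h2 : ψ G = ψ (θ d') * (ψ d * ψ G) := by
      conv_lhs => rw [← hG]
      simp only [map_add, map_mul, map_pow, hψx, zero_pow (hs i).ne', mul_zero, zero_add]
    refine ⟨ψ (θ d') * ψ q, ?_⟩
    apply mul_left_cancel₀ hψG
    rw [map_mul, hψv] at h1
    calc ψ G * v = ψ (θ d') * (ψ d * ψ G) * v := by rw [← h2]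
      _ = ψ (θ d') * (ψ d * v) * ψ G := by ring
      _ = _ := by rw [h1]; ring
  have hrel : IsRelPrime v (ψ G) := by
    refine IsRelPrime.mul_left (IsRelPrime.pow_left (IsUnit.isRelPrime_left ?_))
      (IsRelPrime.prod_left fun l _ => IsRelPrime.pow_left
        ((irreducible_X _).isRelPrime_iff_not_dvd.2 (not_X_dvd_of_atZero_ne_zero ?_ l)))
    · exact isUnit_iff_exists_C.2 ⟨_, inv_ne_zero hc, rfl⟩
    · rwa [hψ, atZero_aeval_update]
  have hunit : IsUnit (ψ G) := hrel.symm.isUnit_of_dvd hdvd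
  have hXdvd : (MvPolynomial.X (Sum.inl i) : PolyXZT k m) ∣ monX s :=
    (dvd_pow_self _ (hs i).ne').trans (X_pow_dvd_monX s i)
  -- In `A'`, `x_i'` divides `G = monX s * y'` and `G - ψ G`, hence the unit `ψ G`.
  refine not_isUnit_incl_X hg hDK i (isUnit_of_dvd_unit ?_ (hunit.map (incl s G)))
  have h3 := map_dvd (incl s G) (X_dvd_sub_aeval_update (Sum.inl i) G)
  rw [map_sub] at h3
  refine (dvd_sub_right ?_).1 h3
  rw [← incl_monX_mul_yy]
  exact (map_dvd (incl s G) hXdvd).mul_right _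

end Isomorphisms


/-! ### Descent to the ideals, to `E` and to `k[Z, T]`. -/

section Consequences

variable {k : Type*} [Field k] {m : ℕ} {r s : Fin m → ℕ} {F G : PolyXZT k m}

theorem val_image_idealB (r : Fin m → ℕ) (F : PolyXZT k m) :
    Subtype.val '' (idealB r F : Set (subB r F)) =
      incl r F '' (Ideal.span {monX r, F} : Ideal (PolyXZT k m)) := by
  set ρ : PolyXZT k m →ₐ[k] subB r F :=
    MvPolynomial.aeval (Sum.elim (bx r F) ![bz r F, bt r F]) with hρ
  have hval : ∀ p, (ρ p : Hyp r F) = incl r F p := by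
    intro p
    have h : (subB r F).val.comp ρ = incl r F := by
      rw [incl_eq_aeval]
      ext v
      rcases v with i | v
      · simp [hρ, bx]
      · fin_cases v <;> simp [hρ, bz, bt]
    exact DFunLike.congr_fun h p
  have hsurj : Function.Surjective ρ := by
    rintro ⟨b, hb⟩
    have hb' := hb
    rw [← range_incl] at hb'
    obtain ⟨p, hp⟩ := hb'
    exact ⟨p, Subtype.ext ((hval p).trans hp)⟩
  have hid : idealB r F = (Ideal.span {monX r, F}).map ρ := by
    rw [Ideal.map_span, Set.image_pair, idealB, monX, map_prod]
    simp [hρ]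
  ext a
  constructor
  · rintro ⟨b, hb, rfl⟩
    rw [hid, SetLike.mem_coe, Ideal.mem_map_iff_of_surjective _ hsurj] at hb
    obtain ⟨p, hp, rfl⟩ := hb
    exact ⟨p, hp, (hval p).symm⟩
  · rintro ⟨p, hp, rfl⟩
    exact ⟨ρ p, hid ▸ Ideal.mem_map_of_mem ρ hp, hval p⟩

theorem map_subE_le {φ : Hyp r F ≃ₐ[k] Hyp s G}
    (h : ∀ i, ∃ j, ∃ c : k, φ (xx r F i) = c • xx s G j) :
    (subE r F).map (φ : Hyp r F →ₐ[k] Hyp s G) ≤ subE s G := by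
  rw [subE, AlgHom.map_adjoin, Algebra.adjoin_le_iff]
  rintro _ ⟨_, ⟨i, rfl⟩, rfl⟩
  obtain ⟨j, c, hc⟩ := h i
  have hmem : c • xx s G j ∈ subE s G :=
    Subalgebra.smul_mem _ (Algebra.subset_adjoin (Set.mem_range_self j)) c
  rw [← hc] at hmem
  exact hmem

theorem map_subE {φ : Hyp r F ≃ₐ[k] Hyp s G} {σ : Equiv.Perm (Fin m)}
    (h : ∀ i, ∃ c : k, c ≠ 0 ∧ φ (xx r F i) = c • xx s G (σ i)) :
    (subE r F).map (φ : Hyp r F →ₐ[k] Hyp s G) = subE s G := by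
  refine le_antisymm (map_subE_le fun i => ⟨σ i, (h i).imp fun _ hc => hc.2⟩) fun b hb => ?_
  have hsymm : ∀ i, ∃ j, ∃ c : k, φ.symm (xx s G i) = c • xx r F j := by
    intro i
    obtain ⟨c, hc, h⟩ := h (σ.symm i)
    refine ⟨σ.symm i, c⁻¹, ?_⟩
    rw [AlgEquiv.symm_apply_eq, map_smul, h, smul_smul, inv_mul_cancel₀ hc, one_smul,
      σ.apply_symm_apply]
  exact ⟨φ.symm b, map_subE_le hsymm ⟨b, hb, rfl⟩, φ.apply_symm_apply b⟩

/-- The evaluation `X_i ↦ 0` as a homomorphism. -/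
def atZeroHom : PolyXZT k m →ₐ[k] MvPolynomial (Fin 2) k :=
  MvPolynomial.aeval (Sum.elim (fun _ => 0) MvPolynomial.X)

theorem atZeroHom_comp_rename :
    (atZeroHom (k := k) (m := m)).comp (MvPolynomial.rename Sum.inr) = AlgHom.id k _ := by
  ext v
  simp [atZeroHom]

/-- The hypothesis says that `atZeroHom.comp θ` kills every `X_i`, so it factors through `k[Z, T]`.
-/
theorem atZeroHom_comp_rename_comp {θ : PolyXZT k m →ₐ[k] PolyXZT k m}
    (h : ∀ i, atZeroHom (θ (MvPolynomial.X (Sum.inl i))) = 0) :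
    ((atZeroHom.comp θ).comp (MvPolynomial.rename Sum.inr)).comp atZeroHom =
      atZeroHom.comp θ := by
  ext v
  rcases v with i | v
  · simp only [AlgHom.comp_apply, h]
    simp [atZeroHom]
  · simp [atZeroHom]

/-- The automorphism of `k[Z, T]` induced by an automorphism of `k[X₁, …, X_m, Z, T]` preserving the
ideal `(X₁, …, X_m)`. -/
def inducedAut (θ : PolyXZT k m ≃ₐ[k] PolyXZT k m)
    (h : ∀ i, atZeroHom (θ (MvPolynomial.X (Sum.inl i))) = 0)
    (h' : ∀ i, atZeroHom (θ.symm (MvPolynomial.X (Sum.inl i))) = 0) :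
    MvPolynomial (Fin 2) k ≃ₐ[k] MvPolynomial (Fin 2) k :=
  AlgEquiv.ofAlgHom ((atZeroHom.comp (θ : PolyXZT k m →ₐ[k] PolyXZT k m)).comp
      (MvPolynomial.rename Sum.inr))
    ((atZeroHom.comp (θ.symm : PolyXZT k m →ₐ[k] PolyXZT k m)).comp
      (MvPolynomial.rename Sum.inr))
    (by
      have h1 := atZeroHom_comp_rename_comp (θ := (θ : PolyXZT k m →ₐ[k] PolyXZT k m)) h
      rw [← AlgHom.comp_assoc, ← AlgHom.comp_assoc, h1, AlgHom.comp_assoc atZeroHom,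
        AlgEquiv.comp_symm, AlgHom.comp_id, atZeroHom_comp_rename])
    (by
      have h1 := atZeroHom_comp_rename_comp (θ := (θ.symm : PolyXZT k m →ₐ[k] PolyXZT k m)) h'
      rw [← AlgHom.comp_assoc, ← AlgHom.comp_assoc, h1, AlgHom.comp_assoc atZeroHom,
        AlgEquiv.symm_comp, AlgHom.comp_id, atZeroHom_comp_rename])

theorem inducedAut_atZero (θ : PolyXZT k m ≃ₐ[k] PolyXZT k m)
    (h : ∀ i, atZeroHom (θ (MvPolynomial.X (Sum.inl i))) = 0)
    (h' : ∀ i, atZeroHom (θ.symm (MvPolynomial.X (Sum.inl i))) = 0) (p : PolyXZT k m) :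
    inducedAut θ h h' (atZero p) = atZero (θ p) :=
  DFunLike.congr_fun
    (atZeroHom_comp_rename_comp (θ := (θ : PolyXZT k m →ₐ[k] PolyXZT k m)) h) p

theorem atZero_dvd_of_mem_span {e G p : PolyXZT k m} (he : atZero e = 0)
    (hp : p ∈ Ideal.span {e, G}) : atZero G ∣ atZero p := by
  obtain ⟨a, b, rfl⟩ := Ideal.mem_span_pair.1 hp
  have h : atZero (a * e + b * G) = atZero (a * e) + atZero (b * G) :=
    map_add (MvPolynomial.aeval _) _ _
  rw [h, atZero_mul, atZero_mul, he, mul_zero, zero_add]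
  exact dvd_mul_left _ _

theorem atZero_monX (hm : 0 < m) (hr : ∀ i, 0 < r i) :
    atZero (monX r : PolyXZT k m) = 0 := by
  obtain ⟨q, hq⟩ := (dvd_pow_self _ (hr ⟨0, hm⟩).ne').trans (X_pow_dvd_monX (k := k) r ⟨0, hm⟩)
  rw [hq, atZero_mul, atZero_X_inl, zero_mul]

end Consequences

end DerksenIso

end

/-! ### The main theorem. -/

open DerksenIso in
theorem mainTheorem4 {k : Type*} [Field k] {m : ℕ} (hm : 0 < m)
    (r s : Fin m → ℕ) (hr : ∀ i, 1 < r i) (hs : ∀ i, 1 < s i)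
    (F G : PolyXZT k m) (hf : atZero F ≠ 0) (hg : atZero G ≠ 0)
    (hDKF : derksenInvariant k (Hyp r F) = subB r F)
    (hDKG : derksenInvariant k (Hyp s G) = subB s G)
    (φ : Hyp r F ≃ₐ[k] Hyp s G) :
    -- (i) `φ` restricts to isomorphisms `B → B'` and `E → E'`
    ((subB r F).map (φ : Hyp r F →ₐ[k] Hyp s G) = subB s G ∧
      (subE r F).map (φ : Hyp r F →ₐ[k] Hyp s G) = subE s G) ∧
    -- (ii)
    ((∀ i, ∃ j, ∃ c : k, c ≠ 0 ∧ φ (xx r F i) = c • xx s G j ∧ r i = s j) ∧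
      ∃ σ : Equiv.Perm (Fin m), ∀ i, r i = s (σ i)) ∧
    -- (iii) equality of subsets of `A'`
    φ '' (Subtype.val '' (idealB r F : Set (subB r F))) =
      Subtype.val '' (idealB s G : Set (subB s G)) ∧
    -- (iv)
    (∃ α : MvPolynomial (Fin 2) k ≃ₐ[k] MvPolynomial (Fin 2) k, ∃ c : k, c ≠ 0 ∧
      α (atZero G) = c • atZero F) := by
  have hr0 : ∀ i, 0 < r i := fun i => zero_lt_one.trans (hr i)
  have hs0 : ∀ i, 0 < s i := fun i => zero_lt_one.trans (hs i)
  have hB : (subB r F).map (φ : Hyp r F →ₐ[k] Hyp s G) = subB s G := by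
    rw [← hDKF, ← hDKG, map_derksenInvariant]
  obtain ⟨θ, hθ⟩ := exists_lift φ hB
  obtain ⟨σ, hσ⟩ := exists_perm_lift_X hθ hg hs0
  have hσ' : ∀ j, ∃ c : k, c ≠ 0 ∧
      θ.symm (MvPolynomial.X (Sum.inl (σ j))) =
        MvPolynomial.C c * MvPolynomial.X (Sum.inl j) := by
    intro j
    obtain ⟨c, hc, h⟩ := hσ j
    refine ⟨c⁻¹, inv_ne_zero hc, ?_⟩
    have hC : θ (MvPolynomial.C c⁻¹) = MvPolynomial.C c⁻¹ := θ.commutes _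
    rw [AlgEquiv.symm_apply_eq, map_mul, h, hC, ← mul_assoc, ← map_mul, inv_mul_cancel₀ hc,
      map_one, one_mul]
  have hrs : ∀ i, r i = s (σ i) := by
    intro i
    obtain ⟨c, hc, h⟩ := hσ i
    obtain ⟨c', hc', h'⟩ := hσ' i
    exact le_antisymm (exponent_le hθ hg hDKG hs0 hc h)
      -- The reverse inequality comes from `φ.symm` and `θ.symm`.
      (exponent_le (incl_lift_symm hθ) hf hDKF hr0 hc' h')
  have hφx : ∀ i, ∃ c : k, c ≠ 0 ∧ φ (xx r F i) = c • xx s G (σ i) := by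
    intro i
    obtain ⟨c, hc, h⟩ := hσ i
    refine ⟨c, hc, ?_⟩
    rw [← incl_X_inl, ← incl_X_inl, ← hθ, h, ← MvPolynomial.smul_eq_C_mul, map_smul]
  have hmon : Associated (θ (monX r)) (monX s) := by
    have h1 : (monX s : PolyXZT k m) =
        ∏ i, MvPolynomial.X (Sum.inl (σ i)) ^ s (σ i) :=
      (Equiv.prod_comp σ fun i => (MvPolynomial.X (Sum.inl i) : PolyXZT k m) ^ s i).symm
    rw [h1, monX, map_prod]
    refine Associated.prod _ _ _ fun i _ => ?_
    obtain ⟨c, hc, h⟩ := hσ i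
    rw [map_pow, h, hrs i]
    exact (associated_unit_mul_left _ _ (isUnit_iff_exists_C.2 ⟨c, hc, rfl⟩)).pow_pow
  have hspan : Ideal.span {θ (monX r), G} = Ideal.span {monX s, G} := by
    rw [Ideal.span_insert, Ideal.span_insert, Ideal.span_singleton_eq_span_singleton.2 hmon]
  have hmem : ∀ p, θ p ∈ Ideal.span {monX s, G} ↔ p ∈ Ideal.span {monX r, F} := by
    intro p
    rw [← hspan]
    exact mem_span_lift_iff hθ dvd_rfl hmon.dvd p
  refine ⟨⟨hB, map_subE hφx⟩, ⟨fun i => ?_, σ, hrs⟩, ?_, ?_⟩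
  · obtain ⟨c, hc, h⟩ := hφx i
    exact ⟨σ i, c, hc, h, hrs i⟩
  · rw [val_image_idealB, val_image_idealB]
    ext a
    constructor
    · rintro ⟨_, ⟨p, hp, rfl⟩, rfl⟩
      exact ⟨θ p, (hmem p).2 hp, hθ p⟩
    · rintro ⟨p, hp, rfl⟩
      refine ⟨_, ⟨θ.symm p, (hmem _).1 (by rwa [θ.apply_symm_apply]), rfl⟩, ?_⟩
      rw [← hθ, θ.apply_symm_apply]
  · have hz : ∀ i, atZeroHom (θ (MvPolynomial.X (Sum.inl i))) = 0 := by
      intro i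
      obtain ⟨c, -, h⟩ := hσ i
      simp [h, atZeroHom]
    have hz' : ∀ i, atZeroHom (θ.symm (MvPolynomial.X (Sum.inl i))) = 0 := by
      intro i
      obtain ⟨c, -, h⟩ := hσ' (σ.symm i)
      rw [σ.apply_symm_apply] at h
      simp [h, atZeroHom]
    have h1 : atZero G ∣ atZero (θ F) :=
      atZero_dvd_of_mem_span (atZero_monX hm hs0)
        ((hmem F).2 (Ideal.subset_span (Or.inr rfl)))
    have h2 : atZero F ∣ atZero (θ.symm G) :=
      atZero_dvd_of_mem_span (atZero_monX hm hr0)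
        ((hmem _).1 (by rw [θ.apply_symm_apply]; exact Ideal.subset_span (Or.inr rfl)))
    -- `β` sends `f` to `θ F` at `X = 0`, an associate of `g`; the required `α` is therefore its
    -- inverse.
    set β := inducedAut θ hz hz' with hβ
    have h3 : atZero F ∣ β.symm (atZero G) := h2.trans (dvd_of_eq (by
      rw [AlgEquiv.eq_symm_apply, hβ, inducedAut_atZero, θ.apply_symm_apply]))
    have h4 : β.symm (atZero G) ∣ atZero F := by
      have h := map_dvd β.symm h1
      rwa [← inducedAut_atZero θ hz hz', ← hβ, AlgEquiv.symm_apply_apply] at h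
    obtain ⟨u, hu⟩ := associated_of_dvd_dvd h3 h4
    obtain ⟨c, hc, huc⟩ := MvPolynomial.isUnit_iff_eq_C_of_isReduced.1 u.isUnit
    refine ⟨β.symm, c, hc.ne_zero, ?_⟩
    rw [← hu, huc, MvPolynomial.smul_eq_C_mul, mul_comm]
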